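/- Let $\varrho>1$, let $\mathcal{E}_\varrho$ be the Bernstein ellipse, i.e. the image of the circle $|z|=\varrho$ under $z\mapsto (z+z^{-1})/2$, and let $f$ be a complex-valued function that is analytic in the open region inside $\mathcal{E}_\varrho$ and satisfies $|f|\le M$ there. Let $w$ be a weight function on $(-1,1)$: integrable, nonnegative almost everywhere, with $\int_{-1}^1 w(x)\,dx>0$. Let $Q\ge 1$ be an integer. A $Q$-point Gauss quadrature formula for $w$ is $I_Qf=\sum_{j=1}^Q w_jf(x_j)$ with real nodes $x_1<\dots<x_Q$ such that $\prod_{j}(x-x_j)$ is orthogonal to all polynomials of degree less than $Q$ with respect to $w(x)\,dx$ on $[-1,1]$, and with weights $w_j=\int_{-1}^1 w(x)\ell_j(x)\,dx$, where $\ell_j$ are the Lagrange basis polynomials of the nodes. Then such a formula exists, and every such formula has its nodes in $(-1,1)$ and weights $w_j>0$, and, with $If=\int_{-1}^1 w(x)f(x)\,dx$, \[ |If-I_Qf|\le 4M\,\frac{\varrho^{-2Q+1}}{\varrho-1}\int_{-1}^1 w(x)\,dx . \] -/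

import Mathlib

open Polynomial

/-- The Bernstein ellipse (a curve): the image of the circle of radius `ρ` around `0` under
`z ↦ (z + z⁻¹) / 2`. -/
def bernsteinEllipse (ρ : ℝ) : Set ℂ :=
  (fun z : ℂ => (z + z⁻¹) / 2) '' Metric.sphere (0 : ℂ) ρ

/-- The open region inside the Bernstein ellipse, which has the semi-axes `(ρ + ρ⁻¹) / 2` (real
direction) and `(ρ - ρ⁻¹) / 2` (imaginary direction). -/
def insideBernsteinEllipse (ρ : ℝ) : Set ℂ :=
  {z : ℂ | (z.re / ((ρ + ρ⁻¹) / 2)) ^ 2 + (z.im / ((ρ - ρ⁻¹) / 2)) ^ 2 < 1}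

/-- The curve `bernsteinEllipse ρ` is the boundary ellipse of `insideBernsteinEllipse ρ`. -/
theorem mem_bernsteinEllipse_iff {ρ : ℝ} (hρ : 1 < ρ) (z : ℂ) :
    z ∈ bernsteinEllipse ρ ↔
      (z.re / ((ρ + ρ⁻¹) / 2)) ^ 2 + (z.im / ((ρ - ρ⁻¹) / 2)) ^ 2 = 1 := by
  have h0 : 0 < ρ := by linarith
  have hinv : ρ⁻¹ < 1 := inv_lt_one_of_one_lt₀ hρ
  have hipos : 0 < ρ⁻¹ := inv_pos.mpr h0
  have ha : (ρ + ρ⁻¹) / 2 ≠ 0 := by positivity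
  have hb : (ρ - ρ⁻¹) / 2 ≠ 0 := by
    have : 0 < ρ - ρ⁻¹ := by linarith
    positivity
  have key : ∀ u : ℂ, u.re ^ 2 + u.im ^ 2 = ρ ^ 2 →
      ((u + u⁻¹) / 2).re = (ρ + ρ⁻¹) / 2 * (u.re / ρ) ∧
      ((u + u⁻¹) / 2).im = (ρ - ρ⁻¹) / 2 * (u.im / ρ) := by
    intro u hu
    have hn : Complex.normSq u = ρ ^ 2 := by rw [Complex.normSq_apply, ← hu]; ring
    have h2 : (2 : ℂ) = ((2 : ℝ) : ℂ) := by norm_num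
    constructor
    · rw [h2, Complex.div_ofReal_re, Complex.add_re, Complex.inv_re, hn]
      field_simp
    · rw [h2, Complex.div_ofReal_im, Complex.add_im, Complex.inv_im, hn]
      field_simp
      ring
  have hs : ∀ u : ℂ, u ∈ Metric.sphere (0 : ℂ) ρ ↔ u.re ^ 2 + u.im ^ 2 = ρ ^ 2 := by
    intro u
    rw [mem_sphere_zero_iff_norm, ← sq_eq_sq₀ (norm_nonneg u) h0.le, Complex.sq_norm,
      Complex.normSq_apply, ← sq, ← sq]
  constructor
  · rintro ⟨u, hu, rfl⟩
    have hu' := (hs u).1 hu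
    obtain ⟨h1, h2⟩ := key u hu'
    simp only [h1, h2]
    rw [mul_div_cancel_left₀ _ ha, mul_div_cancel_left₀ _ hb, div_pow, div_pow, ← add_div, hu']
    exact div_self (by positivity)
  · intro hz
    have hu' : (⟨ρ * (z.re / ((ρ + ρ⁻¹) / 2)), ρ * (z.im / ((ρ - ρ⁻¹) / 2))⟩ : ℂ).re ^ 2 +
        (⟨ρ * (z.re / ((ρ + ρ⁻¹) / 2)), ρ * (z.im / ((ρ - ρ⁻¹) / 2))⟩ : ℂ).im ^ 2 = ρ ^ 2 := by
      simp only [mul_pow, ← mul_add, hz, mul_one]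
    refine ⟨_, (hs _).2 hu', ?_⟩
    obtain ⟨h1, h2⟩ := key _ hu'
    apply Complex.ext
    · rw [h1]
      simp only [mul_div_cancel_left₀ _ h0.ne', mul_div_cancel₀ _ ha]
    · rw [h2]
      simp only [mul_div_cancel_left₀ _ h0.ne', mul_div_cancel₀ _ hb]

/-- `w` is a weight function on `(-1, 1)`: integrable, nonnegative almost everywhere, and of
positive total mass (it need not be bounded, so that Jacobi weights are included). -/
structure IsWeight (w : ℝ → ℝ) : Prop where
  integrable : IntervalIntegrable w MeasureTheory.volume (-1) 1
  nonneg : ∀ᵐ t ∂(MeasureTheory.volume.restrict (Set.Ioo (-1 : ℝ) 1)), 0 ≤ w t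
  mass_pos : 0 < ∫ t in (-1 : ℝ)..1, w t

/-- `x` and `c` are the nodes and the weights of the `Q`-point Gauss quadrature formula on `[-1, 1]`
for the weight function `w`: the nodes, listed in increasing order, are the zeros of the `Q`-th
orthogonal polynomial for `w` (the monic polynomial `∏ j, (X - x j)` of degree `Q` is
orthogonal to all polynomials of smaller degree), and the weights are those of the interpolatory
formula, that is, the weighted integrals of the Lagrange basis polynomials of the nodes. -/
structure IsGaussRule (w : ℝ → ℝ) (Q : ℕ) (x c : Fin Q → ℝ) : Prop where
  strictMono : StrictMono x
  orthogonal : ∀ q : ℝ[X], q.degree < (Q : WithBot ℕ) →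
    ∫ t in (-1 : ℝ)..1, w t * ((∏ j, (X - C (x j))).eval t * q.eval t) = 0
  weight_eq : ∀ j, c j = ∫ t in (-1 : ℝ)..1, w t * (Lagrange.basis Finset.univ x j).eval t

/-! Positivity of `p ↦ ∫ w p` on nonzero polynomials that are nonnegative on `(-1, 1)` drives the
algebraic half: it yields the orthogonal polynomial, forces its zeros to be simple and interior, and
makes the weights positive. Division by the nodal polynomial gives exactness below degree `2 * Q`
(`IsGaussRule.exact`). Since the positive weights sum to the mass of `w`, the error is at most `2 *
E` times that mass whenever a complex polynomial of such degree is within `E` of `f` on `[-1, 1]`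
(`IsGaussRule.norm_error_le`).

The analytic half supplies `E`. Under `x = cos θ` the Chebyshev series of `f` is a Fourier series,
whose coefficients are Laurent coefficients of `f ((z + z⁻¹) / 2)`. Cauchy's theorem on `1 ≤ ‖z‖ ≤ r
< ρ` bounds them by `M * r⁻¹ ^ k`. The frequencies `±k` double the tail from `k = 2 * Q`, which
explains the constant `4 = 2 * 2`; finally `r` tends to `ρ`. -/

/-! ### Positivity of the weight functional -/

/-- The linear functional `p ↦ ∫ w p` on real polynomials. -/
noncomputable def weightFunctional {w : ℝ → ℝ} (hw : IsWeight w) : ℝ[X] →ₗ[ℝ] ℝ where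
  toFun p := ∫ t in (-1 : ℝ)..1, w t * p.eval t
  map_add' p q := by
    simp only [eval_add, mul_add]
    exact intervalIntegral.integral_add (hw.integrable.mul_continuousOn p.continuous.continuousOn)
      (hw.integrable.mul_continuousOn q.continuous.continuousOn)
  map_smul' a p := by
    simp only [eval_smul, smul_eq_mul, RingHom.id_apply, ← intervalIntegral.integral_const_mul]
    congr 1
    ext t
    ring

theorem weightFunctional_apply {w : ℝ → ℝ} (hw : IsWeight w) (p : ℝ[X]) :
    weightFunctional hw p = ∫ t in (-1 : ℝ)..1, w t * p.eval t := rfl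

theorem intervalIntegral_eq_integral_Ioo {E : Type*} [NormedAddCommGroup E] [NormedSpace ℝ E]
    (g : ℝ → E) : ∫ t in (-1 : ℝ)..1, g t = ∫ t in Set.Ioo (-1 : ℝ) 1, g t := by
  rw [intervalIntegral.integral_of_le (by norm_num), MeasureTheory.integral_Ioc_eq_integral_Ioo]

theorem IntervalIntegrable.integrable_Ioo {E : Type*} [NormedAddCommGroup E]
    {g : ℝ → E} (hg : IntervalIntegrable g MeasureTheory.volume (-1) 1) :
    MeasureTheory.Integrable g (MeasureTheory.volume.restrict (Set.Ioo (-1 : ℝ) 1)) :=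
  ((intervalIntegrable_iff_integrableOn_Ioo_of_le (by norm_num)).1 hg)

/-- If the integral vanished, `w * p` would vanish almost everywhere; the finitely many roots of `p`
form a null set, so `w` itself would vanish, against its positive mass. -/
theorem weightFunctional_pos {w : ℝ → ℝ} (hw : IsWeight w) {p : ℝ[X]} (hp : p ≠ 0)
    (hpos : ∀ t ∈ Set.Ioo (-1 : ℝ) 1, 0 ≤ p.eval t) : 0 < weightFunctional hw p := by
  have hae : 0 ≤ᵐ[MeasureTheory.volume.restrict (Set.Ioo (-1 : ℝ) 1)]
      fun t => w t * p.eval t := by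
    filter_upwards [hw.nonneg, MeasureTheory.ae_restrict_mem measurableSet_Ioo] with t h1 h2
    exact mul_nonneg h1 (hpos t h2)
  have hint := (hw.integrable.mul_continuousOn p.continuous.continuousOn).integrable_Ioo
  rw [weightFunctional_apply, intervalIntegral_eq_integral_Ioo]
  refine lt_of_le_of_ne (MeasureTheory.integral_nonneg_of_ae hae) fun h => ?_
  have h0 := (MeasureTheory.integral_eq_zero_iff_of_nonneg_ae hae hint).1 h.symm
  have hroots : ∀ᵐ t ∂(MeasureTheory.volume.restrict (Set.Ioo (-1 : ℝ) 1)), p.eval t ≠ 0 := by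
    refine MeasureTheory.ae_restrict_of_ae ?_
    have hfin : (p.rootSet ℝ).Finite := p.rootSet_finite ℝ
    filter_upwards [hfin.countable.ae_notMem MeasureTheory.volume] with t ht h
    exact ht (by simp [mem_rootSet, hp, h])
  have hw0 : ∫ t in (-1 : ℝ)..1, w t = 0 := by
    rw [intervalIntegral_eq_integral_Ioo]
    refine MeasureTheory.integral_eq_zero_of_ae ?_
    filter_upwards [h0, hroots] with t h1 h2
    exact (mul_eq_zero.1 h1).resolve_right h2
  exact hw.mass_pos.ne' hw0

theorem weightFunctional_ne_zero {w : ℝ → ℝ} (hw : IsWeight w) {p : ℝ[X]} (hp : p ≠ 0)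
    (hsign : (∀ t ∈ Set.Ioo (-1 : ℝ) 1, 0 ≤ p.eval t) ∨
      ∀ t ∈ Set.Ioo (-1 : ℝ) 1, p.eval t ≤ 0) : weightFunctional hw p ≠ 0 := by
  rcases hsign with h | h
  · exact (weightFunctional_pos hw hp h).ne'
  · have := weightFunctional_pos hw (neg_ne_zero.2 hp) fun t ht => by simpa using h t ht
    rw [map_neg] at this
    linarith

/-! ### Orthogonal polynomials and existence of the Gauss rule -/

/-- Every functional on polynomials that is definite on squares admits a monic orthogonal
polynomial of each degree. -/
theorem exists_monic_orthogonal (L : ℝ[X] →ₗ[ℝ] ℝ) (hL : ∀ p, p ≠ 0 → L (p * p) ≠ 0) (n : ℕ) :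
    ∃ P : ℝ[X], P.Monic ∧ P.natDegree = n ∧ ∀ q : ℝ[X], q.degree < n → L (P * q) = 0 := by
  let B : degreeLT ℝ n →ₗ[ℝ] Module.Dual ℝ (degreeLT ℝ n) :=
    ((LinearMap.mul ℝ ℝ[X]).compr₂ L).domRestrict₁₂ (degreeLT ℝ n) (degreeLT ℝ n)
  have hB : ∀ p q, B p q = L (p * q) := fun p q => rfl
  have hinj : Function.Injective B := by
    rw [injective_iff_map_eq_zero]
    intro p hp
    by_contra hne
    exact hL p (by simpa using hne) (by rw [← hB, hp]; rfl)
  have : FiniteDimensional ℝ (degreeLT ℝ n) := (degreeLTEquiv ℝ n).symm.finiteDimensional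
  have hsurj : Function.Surjective B :=
    (LinearMap.injective_iff_surjective_of_finrank_eq_finrank
      Subspace.dual_finrank_eq.symm).1 hinj
  -- `r` represents `q ↦ L (X ^ n * q)` in the nondegenerate form `B`, so `X ^ n - r` is orthogonal
  -- to all lower degrees.
  obtain ⟨r, hr⟩ := hsurj ((((LinearMap.mul ℝ ℝ[X]).compr₂ L) (X ^ n)).domRestrict (degreeLT ℝ n))
  have hdeg : (r : ℝ[X]).degree < n := mem_degreeLT.1 r.2
  refine ⟨X ^ n - (r : ℝ[X]),
    (monic_X_pow n).sub_of_left (by rwa [degree_X_pow]), ?_, fun q hq => ?_⟩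
  · apply natDegree_eq_of_degree_eq_some
    rw [degree_sub_eq_left_of_degree_lt (by rwa [degree_X_pow]), degree_X_pow]
  · have h := LinearMap.congr_fun hr ⟨q, mem_degreeLT.2 hq⟩
    rw [hB] at h
    rw [sub_mul, map_sub, h]
    exact sub_self _

/-- A nonzero real polynomial can be multiplied by distinct linear factors belonging to some of its
roots in `(a, b)` in such a way that the product does not change sign on `(a, b)`. -/
theorem exists_roots_prod_mul_no_sign_change {a b : ℝ} (n : ℕ) :
    ∀ P : ℝ[X], P ≠ 0 → P.natDegree ≤ n → ∃ S : Finset ℝ,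
      (∀ s ∈ S, s ∈ Set.Ioo a b ∧ P.eval s = 0) ∧
      ((∀ t ∈ Set.Ioo a b, 0 ≤ (P * ∏ s ∈ S, (X - C s)).eval t) ∨
        ∀ t ∈ Set.Ioo a b, (P * ∏ s ∈ S, (X - C s)).eval t ≤ 0) := by
  induction n with
  | zero =>
    intro P _ hdeg
    refine ⟨∅, by simp, ?_⟩
    rw [eq_C_of_natDegree_le_zero hdeg]
    simp only [Finset.prod_empty, mul_one, eval_C]
    exact (le_total 0 (P.coeff 0)).imp (fun h _ _ => h) fun h _ _ => h
  | succ n ih =>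
    intro P hP hdeg
    by_cases hroot : ∃ r ∈ Set.Ioo a b, P.eval r = 0
    · obtain ⟨r, hr, hPr⟩ := hroot
      obtain ⟨R, rfl⟩ := dvd_iff_isRoot.2 hPr
      have hR : R ≠ 0 := right_ne_zero_of_mul hP
      rw [natDegree_mul (X_sub_C_ne_zero r) hR, natDegree_X_sub_C] at hdeg
      obtain ⟨S, hS, hsign⟩ := ih R hR (by omega)
      -- If `r` is already in `S`, the new factor replaces the one in `S` and the product is
      -- unchanged; otherwise inserting `r` makes the new factor a square.
      by_cases hrS : r ∈ S
      · refine ⟨S.erase r, fun s hs => ⟨(hS s (Finset.mem_of_mem_erase hs)).1, ?_⟩, ?_⟩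
        · simp [(hS s (Finset.mem_of_mem_erase hs)).2]
        · have : (X - C r) * R * ∏ s ∈ S.erase r, (X - C s) = R * ∏ s ∈ S, (X - C s) := by
            rw [← Finset.mul_prod_erase S _ hrS]
            ring
          rwa [this]
      · refine ⟨insert r S, fun s hs => ?_, ?_⟩
        · rcases Finset.mem_insert.1 hs with rfl | hs
          · exact ⟨hr, hPr⟩
          · exact ⟨(hS s hs).1, by simp [(hS s hs).2]⟩
        · have : ∀ t, ((X - C r) * R * ∏ s ∈ insert r S, (X - C s)).eval t =
              (t - r) ^ 2 * (R * ∏ s ∈ S, (X - C s)).eval t := by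
            intro t
            rw [Finset.prod_insert hrS]
            simp only [eval_mul, eval_sub, eval_X, eval_C]
            ring
          simp only [this]
          exact hsign.imp (fun h t ht => mul_nonneg (sq_nonneg _) (h t ht))
            fun h t ht => mul_nonpos_of_nonneg_of_nonpos (sq_nonneg _) (h t ht)
    · push Not at hroot
      refine ⟨∅, by simp, ?_⟩
      simp only [Finset.prod_empty, mul_one]
      by_contra! hcon
      obtain ⟨⟨s, hs, hs0⟩, t, ht, ht0⟩ := hcon
      obtain ⟨u, hu, hu0⟩ := isPreconnected_Ioo.intermediate_value hs ht
        P.continuous.continuousOn ⟨hs0.le, ht0.le⟩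
      exact hroot u hu hu0

theorem exists_isGaussRule {w : ℝ → ℝ} (hw : IsWeight w) (Q : ℕ) :
    ∃ x c : Fin Q → ℝ, IsGaussRule w Q x c := by
  obtain ⟨P, hmonic, hdeg, horth⟩ := exists_monic_orthogonal (weightFunctional hw)
    (fun p hp => weightFunctional_ne_zero hw (mul_ne_zero hp hp)
      (Or.inl fun t _ => by rw [eval_mul]; exact mul_self_nonneg _)) Q
  obtain ⟨S, hS, hsign⟩ :=
    exists_roots_prod_mul_no_sign_change (a := -1) (b := 1) Q P hmonic.ne_zero hdeg.le
  have hSne : (∏ s ∈ S, (X - C s) : ℝ[X]) ≠ 0 :=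
    Finset.prod_ne_zero_iff.2 fun s _ => X_sub_C_ne_zero s
  have hSdeg : (∏ s ∈ S, (X - C s) : ℝ[X]).degree = S.card := by
    rw [degree_prod]
    simp
  have hle : Q ≤ S.card := by
    -- With fewer than `Q` factors the product would be orthogonal to `P`, although `P` times it has
    -- constant sign.
    by_contra! hlt
    exact weightFunctional_ne_zero hw (mul_ne_zero hmonic.ne_zero hSne) hsign
      (horth _ (by rw [hSdeg]; exact_mod_cast hlt))
  have hge : S.card ≤ Q := by
    rw [← hdeg]
    exact card_le_degree_of_subset_roots fun s hs =>
      (mem_roots hmonic.ne_zero).2 (hS s hs).2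
  have hcard : S.card = Q := le_antisymm hge hle
  have hP : P = ∏ s ∈ S, (X - C s) := by
    refine Polynomial.eq_of_degree_sub_lt_of_eval_finset_eq S ?_ fun s hs => ?_
    · rw [hcard]
      have hPd : P.degree = Q := by rw [degree_eq_natDegree hmonic.ne_zero, hdeg]
      rw [← hPd]
      refine degree_sub_lt_left (by rw [hPd, hSdeg, hcard]) hmonic.ne_zero ?_
      rw [hmonic.leadingCoeff, (monic_prod_of_monic _ _ fun s _ => monic_X_sub_C s).leadingCoeff]
    · rw [(hS s hs).2, eval_prod]
      exact (Finset.prod_eq_zero hs (by simp)).symm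
  refine ⟨S.orderEmbOfFin hcard, _, (S.orderEmbOfFin hcard).strictMono, fun q hq => ?_,
    fun j => rfl⟩
  have hprod : ∏ j, (X - C (S.orderEmbOfFin hcard j)) = P := by
    rw [hP]
    have := Finset.prod_map Finset.univ (S.orderEmbOfFin hcard).toEmbedding
      fun s => (X - C s : ℝ[X])
    simpa using this.symm
  simpa only [weightFunctional_apply, eval_mul, hprod] using horth q hq

/-! ### Exactness, interior nodes, positive weights -/

namespace IsGaussRule

variable {w : ℝ → ℝ} {Q : ℕ} {x c : Fin Q → ℝ}

theorem weightFunctional_nodal_mul (h : IsGaussRule w Q x c) (hw : IsWeight w) {q : ℝ[X]}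
    (hq : q.degree < Q) : weightFunctional hw (Lagrange.nodal Finset.univ x * q) = 0 := by
  rw [weightFunctional_apply]
  simpa only [Lagrange.nodal_eq, eval_mul] using h.orthogonal q hq

/-- A Gauss rule with `Q` nodes is exact for polynomials of degree less than `2 * Q`. -/
theorem exact (h : IsGaussRule w Q x c) (hw : IsWeight w) {p : ℝ[X]} (hp : p.degree < (2 * Q : ℕ)) :
    weightFunctional hw p = ∑ j, c j * p.eval (x j) := by
  set N := Lagrange.nodal Finset.univ x with hN
  have hmonic : N.Monic := Lagrange.nodal_monic
  have hNdeg : N.degree = Q := by rw [hN, Lagrange.degree_nodal]; simp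
  have hinj : Set.InjOn x (Finset.univ : Finset (Fin Q)) := h.strictMono.injective.injOn
  have hmod : (p %ₘ N).degree < Q := hNdeg ▸ degree_modByMonic_lt p hmonic
  have hdiv : (p /ₘ N).degree < Q := by
    by_cases h0 : p /ₘ N = 0
    · rw [h0, degree_zero]
      exact WithBot.bot_lt_coe Q
    · have hp0 : p ≠ 0 := by rintro rfl; simp at h0
      rw [degree_eq_natDegree h0, natDegree_divByMonic p hmonic,
        natDegree_eq_of_degree_eq_some hNdeg]
      rw [degree_eq_natDegree hp0] at hp
      have h1 : p.natDegree < 2 * Q := by exact_mod_cast hp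
      have h2 : p.natDegree - Q < Q := by omega
      exact_mod_cast h2
  have heval : ∀ j, p.eval (x j) = (p %ₘ N).eval (x j) := by
    intro j
    conv_lhs => rw [← modByMonic_add_div p N]
    rw [eval_add, eval_mul, hN, Lagrange.eval_nodal_at_node (Finset.mem_univ j), zero_mul, add_zero]
  -- The quotient part integrates to zero by orthogonality; the remainder is the Lagrange
  -- interpolant of `p`, which the weights integrate by definition.
  have hinterp : p %ₘ N = Lagrange.interpolate Finset.univ x fun j => p.eval (x j) :=
    Lagrange.eq_interpolate_of_eval_eq _ hinj (by simpa using hmod) fun j _ => (heval j).symm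
  conv_lhs => rw [← modByMonic_add_div p N, map_add, h.weightFunctional_nodal_mul hw hdiv, add_zero,
    hinterp, Lagrange.interpolate_apply, map_sum]
  refine Finset.sum_congr rfl fun j _ => ?_
  rw [← smul_eq_C_mul, map_smul, weightFunctional_apply, h.weight_eq, smul_eq_mul, mul_comm]

/-- Let `R` be the nodal polynomial without `x j`. The integral of `w` times `(t - x j) * R ^ 2` is
zero by orthogonality, but this polynomial keeps its sign on `(-1, 1)` if `x j` lies outside. -/
theorem mem_Ioo (h : IsGaussRule w Q x c) (hw : IsWeight w) (j : Fin Q) :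
    x j ∈ Set.Ioo (-1 : ℝ) 1 := by
  by_contra hj
  set R := Lagrange.nodal (Finset.univ.erase j) x with hR
  have hRdeg : R.degree < Q := by
    rw [hR, Lagrange.degree_nodal, Finset.card_erase_of_mem (Finset.mem_univ j), Finset.card_univ,
      Fintype.card_fin]
    have := j.2
    exact_mod_cast (by omega : Q - 1 < Q)
  refine weightFunctional_ne_zero hw
    (mul_ne_zero (Lagrange.nodal_ne_zero (s := Finset.univ) (v := x))
      (Lagrange.nodal_ne_zero (s := Finset.univ.erase j) (v := x))) ?_
    (h.weightFunctional_nodal_mul hw hRdeg)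
  have heval : ∀ t, (Lagrange.nodal Finset.univ x * R).eval t = (t - x j) * R.eval t ^ 2 := by
    intro t
    rw [Lagrange.nodal_eq_mul_nodal_erase (Finset.mem_univ j)]
    simp only [eval_mul, eval_sub, eval_X, eval_C, ← hR]
    ring
  simp only [← hR, heval]
  rw [Set.mem_Ioo, not_and_or, not_lt, not_lt] at hj
  refine hj.imp (fun hj t ht => mul_nonneg ?_ (sq_nonneg _))
    fun hj t ht => mul_nonpos_of_nonpos_of_nonneg ?_ (sq_nonneg _)
  · linarith [ht.1]
  · linarith [ht.2]

/-- The square of a Lagrange basis polynomial has degree `2 * Q - 2`, so the rule integrates it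
exactly, and only its own weight survives. -/
theorem weight_pos (h : IsGaussRule w Q x c) (hw : IsWeight w) (j : Fin Q) : 0 < c j := by
  have hinj : Set.InjOn x (Finset.univ : Finset (Fin Q)) := h.strictMono.injective.injOn
  set l := Lagrange.basis Finset.univ x j with hl
  have hl0 : l ≠ 0 := Lagrange.basis_ne_zero hinj (Finset.mem_univ j)
  have hdeg : (l * l).degree < (2 * Q : ℕ) := by
    rw [degree_mul, hl, Lagrange.degree_basis hinj (Finset.mem_univ j), Finset.card_univ,
      Fintype.card_fin]
    have := j.2
    exact_mod_cast (by omega : Q - 1 + (Q - 1) < 2 * Q)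
  have hpos := weightFunctional_pos hw (mul_ne_zero hl0 hl0) fun t _ => by
    rw [eval_mul]
    exact mul_self_nonneg _
  rw [h.exact hw hdeg, Finset.sum_eq_single j] at hpos
  · simpa [hl, Lagrange.eval_basis_self hinj (Finset.mem_univ j)] using hpos
  · intro i _ hij
    simp [hl, Lagrange.eval_basis_of_ne hij.symm (Finset.mem_univ i)]
  · simp

theorem sum_weights (h : IsGaussRule w Q x c) (hw : IsWeight w) (hQ : 1 ≤ Q) :
    ∑ j, c j = ∫ t in (-1 : ℝ)..1, w t := by
  have h1 := h.exact hw (p := 1) (by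
    rw [degree_one]
    exact_mod_cast (by omega : 0 < 2 * Q))
  simpa [weightFunctional_apply] using h1.symm

end IsGaussRule

/-! ### The Joukowski map -/

theorem joukowski_mem_insideBernsteinEllipse {ρ : ℝ} {z : ℂ} (h1 : 1 ≤ ‖z‖) (hρ : ‖z‖ < ρ) :
    (z + z⁻¹) / 2 ∈ insideBernsteinEllipse ρ := by
  set s := ‖z‖ with hs
  have hs0 : 0 < s := by linarith
  have hρ0 : 0 < ρ := by linarith
  have hinv : ρ⁻¹ < s⁻¹ := inv_strictAnti₀ hs0 hρ
  have hs1 : s⁻¹ ≤ 1 := inv_le_one_of_one_le₀ h1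
  have hsi : 0 < s⁻¹ := by positivity
  have hn : Complex.normSq z = s ^ 2 := by rw [hs, Complex.sq_norm]
  have hxy : (z.re / s) ^ 2 + (z.im / s) ^ 2 = 1 := by
    rw [div_pow, div_pow, ← add_div, ← hn, Complex.normSq_apply, ← sq, ← sq]
    refine div_self ?_
    rw [sq, sq, ← Complex.normSq_apply, hn]
    positivity
  have h2 : (2 : ℂ) = ((2 : ℝ) : ℂ) := by norm_num
  have hre : ((z + z⁻¹) / 2).re = (s + s⁻¹) / 2 * (z.re / s) := by
    rw [h2, Complex.div_ofReal_re, Complex.add_re, Complex.inv_re, hn]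
    field_simp
  have him : ((z + z⁻¹) / 2).im = (s - s⁻¹) / 2 * (z.im / s) := by
    rw [h2, Complex.div_ofReal_im, Complex.add_im, Complex.inv_im, hn]
    field_simp
    ring
  have hprod : s⁻¹ * ρ⁻¹ < 1 := by nlinarith [inv_pos.2 hρ0]
  have ha : s + s⁻¹ < ρ + ρ⁻¹ := by
    have hid : ρ + ρ⁻¹ - (s + s⁻¹) = (ρ - s) * (1 - s⁻¹ * ρ⁻¹) := by field_simp; ring
    have := mul_pos (sub_pos.2 hρ) (sub_pos.2 hprod)
    linarith
  have hA : ((s + s⁻¹) / 2 / ((ρ + ρ⁻¹) / 2)) ^ 2 < 1 := by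
    have h0 : 0 < (ρ + ρ⁻¹) / 2 := by positivity
    refine pow_lt_one₀ (by positivity) ((div_lt_one h0).2 (by linarith)) two_ne_zero
  have hB : ((s - s⁻¹) / 2 / ((ρ - ρ⁻¹) / 2)) ^ 2 < 1 := by
    have h0 : 0 < (ρ - ρ⁻¹) / 2 := by linarith
    refine pow_lt_one₀ (div_nonneg (by linarith) h0.le) ((div_lt_one h0).2 (by linarith))
      two_ne_zero
  change _ + _ < (1 : ℝ)
  rw [hre, him, mul_div_right_comm, mul_div_right_comm, mul_pow, mul_pow]
  -- A convex combination of two numbers below 1; strictness has to come from a nonzero coefficient.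
  by_cases hx : z.re / s = 0
  · simp only [hx, zero_pow two_ne_zero, zero_add] at hxy ⊢
    rw [hxy]
    linarith
  · have hx2 : 0 < (z.re / s) ^ 2 := by positivity
    linarith [mul_lt_mul_of_pos_right hA hx2,
      mul_le_mul_of_nonneg_right hB.le (sq_nonneg (z.im / s))]

theorem joukowski_circleMap_one (θ : ℝ) :
    (circleMap 0 1 θ + (circleMap 0 1 θ)⁻¹) / 2 = (Real.cos θ : ℂ) := by
  rw [circleMap_zero, Complex.ofReal_one, one_mul, ← Complex.exp_neg, Complex.ofReal_cos,
    Complex.cos, neg_mul]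

theorem ofReal_mem_insideBernsteinEllipse {ρ : ℝ} (hρ : 1 < ρ) {x : ℝ}
    (hx : x ∈ Set.Icc (-1 : ℝ) 1) : (x : ℂ) ∈ insideBernsteinEllipse ρ := by
  rw [← Real.cos_arccos hx.1 hx.2, ← joukowski_circleMap_one]
  exact joukowski_mem_insideBernsteinEllipse (by simp) (by simpa using hρ)

/-- The average is a multiple of the contour integral of `g z / z`, so Cauchy's theorem allows the
circle to be moved. -/
theorem circleAverage_eq_of_differentiableAt_annulus {g : ℂ → ℂ} {r R : ℝ} (hr : 0 < r)
    (hrR : r ≤ R) (hg : ∀ z : ℂ, r ≤ ‖z‖ → ‖z‖ ≤ R → DifferentiableAt ℂ g z) :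
    Real.circleAverage g 0 R = Real.circleAverage g 0 r := by
  rw [Real.circleAverage_eq_circleIntegral hr.ne',
    Real.circleAverage_eq_circleIntegral (hr.trans_le hrR).ne']
  congr 1
  refine Complex.circleIntegral_sub_center_inv_smul_eq_of_differentiable_on_annulus_off_countable
    hr hrR Set.countable_empty (fun z hz => ?_) fun z hz => ?_
  · simp only [Set.mem_sdiff, Metric.mem_closedBall, Metric.mem_ball, dist_zero_right, not_lt] at hz
    exact (hg z hz.2 hz.1).continuousAt.continuousWithinAt
  · simp only [Set.mem_sdiff, Metric.mem_closedBall, Metric.mem_ball, dist_zero_right, not_le,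
      Set.mem_empty_iff_false, not_false_eq_true, and_true] at hz
    exact hg z hz.2.le hz.1.le

-- Fourier coefficients and Chebyshev approximation

local instance fact_zero_lt_two_pi : Fact (0 < 2 * Real.pi) := ⟨Real.two_pi_pos⟩

theorem fourierCoeff_neg_of_even {T : ℝ} [Fact (0 < T)] {F : AddCircle T → ℂ}
    (hF : ∀ t, F (-t) = F t) (n : ℤ) : fourierCoeff F (-n) = fourierCoeff F n := by
  rw [fourierCoeff, fourierCoeff, ← MeasureTheory.integral_neg_eq_self]
  congr 1
  ext t
  rw [hF]
  simp [fourier_apply]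

/-- The Fourier coefficients of `θ ↦ f (cos θ)` are Laurent coefficients of
`z ↦ f ((z + z⁻¹) / 2)`. -/
theorem fourierCoeff_comp_cos (f : ℂ → ℂ) (n : ℕ) :
    fourierCoeff (T := 2 * Real.pi) (fun θ => f (Real.Angle.cos θ : ℝ)) n =
      Real.circleAverage (fun z => (z ^ n)⁻¹ * f ((z + z⁻¹) / 2)) 0 1 := by
  rw [fourierCoeff_eq_intervalIntegral _ _ 0, Real.circleAverage, zero_add, one_div]
  congr 1
  refine intervalIntegral.integral_congr fun θ _ => ?_
  have h1 : Real.Angle.cos ((θ : AddCircle (2 * Real.pi))) = Real.cos θ := Real.Angle.cos_coe θ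
  simp only [joukowski_circleMap_one, h1, smul_eq_mul]
  congr 1
  rw [fourier_coe_apply, circleMap_zero, Complex.ofReal_one, one_mul, ← Complex.exp_nat_mul,
    ← Complex.exp_neg]
  congr 1
  have := Real.pi_ne_zero
  push_cast
  field_simp

/-- The unit circle is moved out to radius `r`, where the factor `z ^ n` in the denominator has
modulus `r ^ n`. -/
theorem norm_fourierCoeff_comp_cos_le {ρ M r : ℝ} {f : ℂ → ℂ}
    (hf : AnalyticOnNhd ℂ f (insideBernsteinEllipse ρ))
    (hM : ∀ z ∈ insideBernsteinEllipse ρ, ‖f z‖ ≤ M) (hr : 1 < r) (hrρ : r < ρ) (n : ℕ) :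
    ‖fourierCoeff (T := 2 * Real.pi) (fun θ => f (Real.Angle.cos θ : ℝ)) n‖ ≤ M * r⁻¹ ^ n := by
  have hr0 : 0 < r := by linarith
  rw [fourierCoeff_comp_cos,
    ← circleAverage_eq_of_differentiableAt_annulus one_pos hr.le fun z h1 h2 => ?_]
  · rw [Real.circleAverage, norm_smul, Real.norm_eq_abs, abs_of_pos (inv_pos.2 Real.two_pi_pos)]
    have hb := intervalIntegral.norm_integral_le_of_norm_le_const (a := 0) (b := 2 * Real.pi)
      (C := M * r⁻¹ ^ n)
      (f := fun θ => (circleMap 0 r θ ^ n)⁻¹ * f ((circleMap 0 r θ + (circleMap 0 r θ)⁻¹) / 2))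
      fun θ _ => by
        have hn : ‖circleMap 0 r θ‖ = r := by simp [abs_of_pos hr0]
        rw [norm_mul, norm_inv, norm_pow, hn, mul_comm, inv_pow]
        gcongr
        exact hM _ (joukowski_mem_insideBernsteinEllipse (by rw [hn]; exact hr.le)
          (by rwa [hn]))
    rw [sub_zero, abs_of_pos Real.two_pi_pos] at hb
    calc _ ≤ (2 * Real.pi)⁻¹ * (M * r⁻¹ ^ n * (2 * Real.pi)) := by gcongr
      _ = M * r⁻¹ ^ n := by field_simp
  · have hz : z ≠ 0 := norm_pos_iff.1 (by linarith)
    have hfz := (hf _ (joukowski_mem_insideBernsteinEllipse h1 (h2.trans_lt hrρ))).differentiableAt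
    have hJ : DifferentiableAt ℂ (fun z : ℂ => (z + z⁻¹) / 2) z :=
      (differentiableAt_id.add (differentiableAt_inv hz)).div_const 2
    exact ((differentiableAt_id.pow n).inv (pow_ne_zero n hz)).mul (hfz.comp z hJ)

/-- A bounded analytic function in a Bernstein ellipse is approximated on `[-1, 1]` by partial sums
of a Chebyshev series, at a geometric rate. -/
theorem exists_chebyshev_approx {ρ M r : ℝ} {f : ℂ → ℂ}
    (hf : AnalyticOnNhd ℂ f (insideBernsteinEllipse ρ))
    (hM : ∀ z ∈ insideBernsteinEllipse ρ, ‖f z‖ ≤ M) (hr : 1 < r) (hrρ : r < ρ) {n : ℕ}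
    (hn : 1 ≤ n) :
    ∃ b : ℕ → ℂ, ∀ x ∈ Set.Icc (-1 : ℝ) 1,
      ‖f x - ∑ k ∈ Finset.range n, b k * ((Chebyshev.T ℝ k).eval x : ℝ)‖ ≤
        2 * M * (r⁻¹ ^ n * (1 - r⁻¹)⁻¹) := by
  have hr0 : 0 < r := by linarith
  have hri : r⁻¹ < 1 := inv_lt_one_of_one_lt₀ hr
  let F : C(AddCircle (2 * Real.pi), ℂ) :=
    { toFun := fun θ => f (Real.Angle.cos θ : ℝ)
      continuous_toFun := by
        rw [continuous_iff_continuousAt]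
        intro θ
        have hmem : ((Real.Angle.cos θ : ℝ) : ℂ) ∈ insideBernsteinEllipse ρ := by
          induction θ using Real.Angle.induction_on with
          | _ t =>
            rw [Real.Angle.cos_coe]
            exact ofReal_mem_insideBernsteinEllipse (hr.trans hrρ)
              ⟨Real.neg_one_le_cos t, Real.cos_le_one t⟩
        exact ContinuousAt.comp (f := fun θ => ((Real.Angle.cos θ : ℝ) : ℂ)) (g := f)
          (hf _ hmem).continuousAt
          (Complex.continuous_ofReal.comp Real.Angle.continuous_cos).continuousAt }
  set a : ℕ → ℂ := fun k => fourierCoeff F k with ha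
  have hbound : ∀ k, ‖a k‖ ≤ M * r⁻¹ ^ k := norm_fourierCoeff_comp_cos_le hf hM hr hrρ
  have heven : ∀ k : ℤ, fourierCoeff F (-k) = fourierCoeff F k :=
    fourierCoeff_neg_of_even fun t =>
      congrArg (fun u : ℝ => f u) (Real.Angle.cos_neg (t : Real.Angle))
  have hgeo : Summable fun k : ℕ => M * r⁻¹ ^ k :=
    (summable_geometric_of_lt_one (by positivity) hri).mul_left M
  have hsa : Summable a := .of_norm_bounded hgeo hbound
  have hsum : Summable (fourierCoeff F) :=
    Summable.of_nat_of_neg hsa (by simpa only [heven] using hsa)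
  refine ⟨fun k => if k = 0 then a 0 else 2 * a k, fun x hx => ?_⟩
  set θ := Real.arccos x
  have hθ : Real.cos θ = x := Real.cos_arccos hx.1 hx.2
  have hT : ∀ k : ℕ, (Chebyshev.T ℝ k).eval x = Real.cos (k * θ) := fun k => by
    rw [← hθ, Chebyshev.T_real_cos]
    simp
  have hfour : ∀ k : ℤ, (fourier k (θ : AddCircle (2 * Real.pi)) : ℂ) =
      Complex.exp (k * θ * Complex.I) := fun k => by
    rw [fourier_coe_apply]
    congr 1
    have := Real.pi_ne_zero
    push_cast
    field_simp
  have hF : F (θ : AddCircle (2 * Real.pi)) = f x := by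
    change f (Real.Angle.cos (θ : Real.Angle) : ℝ) = f x
    rw [Real.Angle.cos_coe, hθ]
  -- Pairing `k` with `-k` counts the zeroth term twice, hence the surplus `a 0` in `hS'`. It
  -- cancels against the partial sum because `1 ≤ n`.
  have hS := (has_pointwise_sum_fourier_series_of_summable hsum θ).nat_add_neg
  rw [hF] at hS
  have hS' : HasSum (fun k : ℕ => 2 * a k * (Real.cos (k * θ) : ℂ)) (f x + a 0) := by
    convert hS using 1
    · ext k
      rw [heven, hfour, hfour]
      simp only [ha, smul_eq_mul, Complex.ofReal_cos, Complex.cos]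
      push_cast
      ring_nf
    · simp [ha]
  have hpart : ∑ k ∈ Finset.range n, 2 * a k * (Real.cos (k * θ) : ℂ) =
      a 0 + ∑ k ∈ Finset.range n,
        (if k = 0 then a 0 else 2 * a k) * ((Chebyshev.T ℝ k).eval x : ℝ) := by
    obtain ⟨m, rfl⟩ : ∃ m, n = m + 1 := ⟨n - 1, by omega⟩
    rw [Finset.sum_range_succ', Finset.sum_range_succ']
    simp only [hT, Nat.succ_ne_zero, if_false, if_true, Nat.cast_zero, zero_mul, Chebyshev.T_zero, eval_one,
      Real.cos_zero, Complex.ofReal_one]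
    have hz : ∀ A z : ℂ, A + 2 * z * 1 = z + (A + z * 1) := fun A z => by ring
    exact hz _ _
  have htail := (hasSum_nat_add_iff' n).2 hS'
  rw [hpart, add_comm (a 0), add_sub_add_right_eq_sub] at htail
  refine htail.norm_le_of_bounded (((hasSum_geometric_of_lt_one (by positivity) hri).mul_left
    (r⁻¹ ^ n)).mul_left (2 * M)) fun k => ?_
  have hcos : ‖(Real.cos ((k + n : ℕ) * θ) : ℂ)‖ ≤ 1 := by
    rw [Complex.norm_real]
    exact Real.abs_cos_le_one _
  rw [norm_mul, norm_mul, Complex.norm_ofNat, ← pow_add, add_comm n k]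
  have := hbound (k + n)
  calc 2 * ‖a (k + n)‖ * ‖(Real.cos ((k + n : ℕ) * θ) : ℂ)‖ ≤ 2 * ‖a (k + n)‖ * 1 := by gcongr
    _ ≤ 2 * M * r⁻¹ ^ (k + n) := by linarith

/-! ### Error estimate for the Gauss rule -/

theorem IntervalIntegrable.complex_ofReal {g : ℝ → ℝ} {a b : ℝ} {μ : MeasureTheory.Measure ℝ}
    (hg : IntervalIntegrable g μ a b) : IntervalIntegrable (fun t => (g t : ℂ)) μ a b :=
  ⟨MeasureTheory.Integrable.ofReal hg.1, MeasureTheory.Integrable.ofReal hg.2⟩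

theorem IsGaussRule.exact_complex {w : ℝ → ℝ} {Q : ℕ} {x c : Fin Q → ℝ} (h : IsGaussRule w Q x c)
    (hw : IsWeight w) {n : ℕ} (b : ℕ → ℂ) (p : ℕ → ℝ[X])
    (hp : ∀ k < n, (p k).degree < (2 * Q : ℕ)) :
    ∫ t in (-1 : ℝ)..1, (w t : ℂ) * ∑ k ∈ Finset.range n, b k * ((p k).eval t : ℝ) =
      ∑ j, (c j : ℂ) * ∑ k ∈ Finset.range n, b k * ((p k).eval (x j) : ℝ) := by
  have hint : ∀ k, IntervalIntegrable (fun t => b k * ((w t * (p k).eval t : ℝ) : ℂ))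
      MeasureTheory.volume (-1) 1 := fun k =>
    (hw.integrable.mul_continuousOn (p k).continuous.continuousOn).complex_ofReal.const_mul (b k)
  calc _ = ∫ t in (-1 : ℝ)..1, ∑ k ∈ Finset.range n, b k * ((w t * (p k).eval t : ℝ) : ℂ) := by
        congr 1
        ext t
        rw [Finset.mul_sum]
        refine Finset.sum_congr rfl fun k _ => ?_
        push_cast
        ring
    _ = ∑ k ∈ Finset.range n, b k * ((∑ j, c j * (p k).eval (x j) : ℝ) : ℂ) := by
        rw [intervalIntegral.integral_finsetSum fun k _ => hint k]
        refine Finset.sum_congr rfl fun k hk => ?_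
        rw [intervalIntegral.integral_const_mul, intervalIntegral.integral_ofReal,
          ← weightFunctional_apply hw, h.exact hw (hp k (Finset.mem_range.1 hk))]
    _ = _ := by
        simp only [Complex.ofReal_sum, Finset.mul_sum]
        rw [Finset.sum_comm]
        refine Finset.sum_congr rfl fun j _ => Finset.sum_congr rfl fun k _ => ?_
        push_cast
        ring

/-- The error of a Gauss rule is at most twice the error of uniform approximation by polynomials of
degree less than `2 * Q`, times the total mass of the weight. -/
theorem IsGaussRule.norm_error_le {w : ℝ → ℝ} {Q : ℕ} {x c : Fin Q → ℝ} (h : IsGaussRule w Q x c)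
    (hw : IsWeight w) (hQ : 1 ≤ Q) {g : ℝ → ℂ} (hg : ContinuousOn g (Set.Icc (-1) 1)) {n : ℕ}
    (b : ℕ → ℂ) (p : ℕ → ℝ[X]) (hp : ∀ k < n, (p k).degree < (2 * Q : ℕ)) {E : ℝ}
    (hE : ∀ t ∈ Set.Icc (-1 : ℝ) 1,
      ‖g t - ∑ k ∈ Finset.range n, b k * ((p k).eval t : ℝ)‖ ≤ E) :
    ‖(∫ t in (-1 : ℝ)..1, (w t : ℂ) * g t) - ∑ j, (c j : ℂ) * g (x j)‖ ≤
      2 * E * ∫ t in (-1 : ℝ)..1, w t := by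
  set s : ℝ → ℂ := fun t => ∑ k ∈ Finset.range n, b k * ((p k).eval t : ℝ) with hs
  have hsc : Continuous s := continuous_finsetSum _ fun k _ =>
    continuous_const.mul (Complex.continuous_ofReal.comp (p k).continuous)
  have hwc : IntervalIntegrable (fun t => (w t : ℂ)) MeasureTheory.volume (-1) 1 :=
    hw.integrable.complex_ofReal
  have huIcc : Set.uIcc (-1 : ℝ) 1 = Set.Icc (-1) 1 := Set.uIcc_of_le (by norm_num)
  have hexact : ∫ t in (-1 : ℝ)..1, (w t : ℂ) * s t = ∑ j, (c j : ℂ) * s (x j) :=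
    h.exact_complex hw b p hp
  -- By exactness `s` can be subtracted from `g` in both the integral and the sum.
  have hsplit : (∫ t in (-1 : ℝ)..1, (w t : ℂ) * g t) - ∑ j, (c j : ℂ) * g (x j) =
      (∫ t in (-1 : ℝ)..1, (w t : ℂ) * (g t - s t)) - ∑ j, (c j : ℂ) * (g (x j) - s (x j)) := by
    simp only [mul_sub]
    rw [intervalIntegral.integral_sub (hwc.mul_continuousOn (by rwa [huIcc]))
      (hwc.mul_continuousOn hsc.continuousOn), hexact, Finset.sum_sub_distrib]
    ring
  have hI : ‖∫ t in (-1 : ℝ)..1, (w t : ℂ) * (g t - s t)‖ ≤ E * ∫ t in (-1 : ℝ)..1, w t := by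
    rw [← intervalIntegral.integral_const_mul, intervalIntegral_eq_integral_Ioo,
      intervalIntegral_eq_integral_Ioo]
    refine MeasureTheory.norm_integral_le_of_norm_le (hw.integrable.const_mul E).integrable_Ioo ?_
    filter_upwards [hw.nonneg, MeasureTheory.ae_restrict_mem measurableSet_Ioo] with t h1 h2
    rw [norm_mul, Complex.norm_real, Real.norm_of_nonneg h1, mul_comm]
    exact mul_le_mul_of_nonneg_right (hE t (Set.Ioo_subset_Icc_self h2)) h1
  have hS : ‖∑ j, (c j : ℂ) * (g (x j) - s (x j))‖ ≤ E * ∫ t in (-1 : ℝ)..1, w t := by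
    rw [← h.sum_weights hw hQ, Finset.mul_sum]
    refine norm_sum_le_of_le _ fun j _ => ?_
    have hc := (h.weight_pos hw j).le
    rw [norm_mul, Complex.norm_real, Real.norm_of_nonneg hc, mul_comm]
    exact mul_le_mul_of_nonneg_right (hE _ (Set.Ioo_subset_Icc_self (h.mem_Ioo hw j))) hc
  rw [hsplit]
  linarith [norm_sub_le (∫ t in (-1 : ℝ)..1, (w t : ℂ) * (g t - s t))
    (∑ j, (c j : ℂ) * (g (x j) - s (x j)))]

theorem mainTheorem8 (ρ : ℝ) (hρ : 1 < ρ) (M : ℝ) (f : ℂ → ℂ)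
    (hf : AnalyticOnNhd ℂ f (insideBernsteinEllipse ρ))
    (hM : ∀ z ∈ insideBernsteinEllipse ρ, ‖f z‖ ≤ M)
    (w : ℝ → ℝ) (hw : IsWeight w) (Q : ℕ) (hQ : 1 ≤ Q) :
    (∃ x c : Fin Q → ℝ, IsGaussRule w Q x c) ∧
    ∀ x c : Fin Q → ℝ, IsGaussRule w Q x c →
      (∀ j, x j ∈ Set.Ioo (-1 : ℝ) 1) ∧ (∀ j, 0 < c j) ∧
      ‖(∫ t in (-1 : ℝ)..1, (w t : ℂ) * f (t : ℂ)) - ∑ j, (c j : ℂ) * f (x j : ℂ)‖ ≤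
        4 * M * (ρ ^ (-2 * (Q : ℤ) + 1) / (ρ - 1)) * ∫ t in (-1 : ℝ)..1, w t := by
  refine ⟨exists_isGaussRule hw Q, fun x c h => ⟨h.mem_Ioo hw, h.weight_pos hw, ?_⟩⟩
  have hcont : ContinuousOn (fun t : ℝ => f t) (Set.Icc (-1) 1) := fun t ht =>
    (ContinuousAt.comp (f := fun t : ℝ => (t : ℂ)) (g := f)
      (hf _ (ofReal_mem_insideBernsteinEllipse hρ ht)).continuousAt
      Complex.continuous_ofReal.continuousAt).continuousWithinAt
  have hbound : ∀ r ∈ Set.Ioo 1 ρ,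
      ‖(∫ t in (-1 : ℝ)..1, (w t : ℂ) * f (t : ℂ)) - ∑ j, (c j : ℂ) * f (x j : ℂ)‖ ≤
        2 * (2 * M * (r⁻¹ ^ (2 * Q) * (1 - r⁻¹)⁻¹)) * ∫ t in (-1 : ℝ)..1, w t := by
    intro r hr
    obtain ⟨b, hb⟩ := exists_chebyshev_approx hf hM hr.1 hr.2 (n := 2 * Q) (by omega)
    refine h.norm_error_le hw hQ hcont b (fun k => Chebyshev.T ℝ k) (fun k hk => ?_) hb
    rw [Chebyshev.degree_T, Int.natAbs_natCast]
    exact_mod_cast hk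
  have hρ0 : ρ ≠ 0 := by linarith
  have hρ1 : ρ - 1 ≠ 0 := by linarith
  have hi : 1 - ρ⁻¹ ≠ 0 := (sub_pos.2 (inv_lt_one_of_one_lt₀ hρ)).ne'
  -- Nothing is assumed about `f` on the ellipse itself, so the bound at `ρ` is reached as a limit
  -- from `r < ρ`.
  have hlim : Filter.Tendsto
      (fun r : ℝ => 2 * (2 * M * (r⁻¹ ^ (2 * Q) * (1 - r⁻¹)⁻¹)) * ∫ t in (-1 : ℝ)..1, w t)
      (nhdsWithin ρ (Set.Iio ρ))
      (nhds (2 * (2 * M * (ρ⁻¹ ^ (2 * Q) * (1 - ρ⁻¹)⁻¹)) * ∫ t in (-1 : ℝ)..1, w t)) := by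
    have hinv : ContinuousAt (fun r : ℝ => r⁻¹) ρ := continuousAt_inv₀ hρ0
    have : ContinuousAt
        (fun r : ℝ => 2 * (2 * M * (r⁻¹ ^ (2 * Q) * (1 - r⁻¹)⁻¹)) * ∫ t in (-1 : ℝ)..1, w t) ρ :=
      (continuousAt_const.mul (continuousAt_const.mul
        ((hinv.pow _).mul ((continuousAt_const.sub hinv).inv₀ hi)))).mul continuousAt_const
    exact this.tendsto.mono_left nhdsWithin_le_nhds
  have hle := ge_of_tendsto hlim (Filter.mem_of_superset (Ioo_mem_nhdsLT hρ) hbound)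
  have hval : ρ ^ (-2 * (Q : ℤ) + 1) / (ρ - 1) = ρ⁻¹ ^ (2 * Q) * (1 - ρ⁻¹)⁻¹ := by
    have h2 : (-2 * (Q : ℤ)) = -((2 * Q : ℕ) : ℤ) := by push_cast; ring
    have h3 : 1 - ρ⁻¹ = (ρ - 1) / ρ := by field_simp
    rw [zpow_add_one₀ hρ0, h2, zpow_neg, zpow_natCast, inv_pow, h3, inv_div, mul_div_assoc]
  rw [hval]
  linarith
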